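/- For an integer $q$ and a subset $A$ of $\mathbb{R}^d$ write $q\cdot A=\{qa : a\in A\}$, and let the dimension of $A$ be the dimension of the affine subspace it spans. Let $q,s$ be coprime integers with $qs>1$. Then there is a least real number $C_{q,s}$ such that $$|q\cdot B+s\cdot B|\ \ge\ (|q|+|s|)\,|B|-C_{q,s}\qquad\text{for every finite } B\subseteq\mathbb{R}.$$ For every integer $d\ge 1$ put $$K_{q,s,d}=d(d+1)\,C_{q,s}+d(d+1)+C_{q,s}.$$ Let $d\ge 1$, let $l_1,\dots,l_r$ be $r$ parallel lines in $\mathbb{R}^d$, and let $A$ be a finite $d$-dimensional subset of $\mathbb{R}^d$ with $A\subseteq l_1\cup\dots\cup l_r$. Then $$|q\cdot A+s\cdot A|\ \ge\ (|q|+|s|+2d-2)\,|A|-K_{q,s,d}\,r .$$ -/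

import Mathlib

open scoped Pointwise

noncomputable section

/-- `C` is an admissible additive constant for sums of the dilates `q • B` and `s • B` of finite
sets of real numbers: `|q · B + s · B| ≥ (|q| + |s|) |B| - C` for every finite `B ⊆ ℝ`. -/
def IsDilateConst (q s : ℤ) (C : ℝ) : Prop :=
  ∀ B : Set ℝ, B.Finite →
    (|(q : ℝ)| + |(s : ℝ)|) * (B.ncard : ℝ) - C ≤ (((q : ℝ) • B + (s : ℝ) • B).ncard : ℝ)

/-- The constant `C_{q,s}`: the smallest admissible additive constant. It is smaller than or
equal to any other admissible choice. -/
def dilateConst (q s : ℤ) : ℝ := sInf {C : ℝ | IsDilateConst q s C}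

/-- The constant `K_{q,s,d} = d(d+1) C_{q,s} + d(d+1) + C_{q,s}`. -/
def linesConst (q s : ℤ) (d : ℕ) : ℝ :=
  (d : ℝ) * (d + 1) * dilateConst q s + (d : ℝ) * (d + 1) + dilateConst q s

/-- The dimension of a set: the dimension of the affine subspace that it spans. -/
def affineDim {d : ℕ} (A : Set (EuclideanSpace ℝ (Fin d))) : ℕ :=
  Module.finrank ℝ (affineSpan ℝ A).direction

/-- A line: a one-dimensional affine subspace. (It is nonempty, since the empty affine subspace
has direction `⊥`.) -/
def IsLine {d : ℕ} (l : AffineSubspace ℝ (EuclideanSpace ℝ (Fin d))) : Prop :=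
  Module.finrank ℝ l.direction = 1

end

/-! Since `q * s > 1`, the two coefficients have the same sign, and negating both preserves every
cardinality; so both may be taken positive, and coprimality makes them distinct.

The existence of an additive constant is first proved for sets of integers, by bootstrapping the
slope. Suppose a bound with slope `m` holds for all finite sets. After normalising the differences
of `A` to be coprime, either some class modulo `q` produces sums with new residues modulo `q ^ 2`,
which raises the slope by a fixed `δ`, or every class met by `A` fills all its subclasses modulo `q
^ 2` (`improved_bound_or_isSaturated`). In the second case each class rescales to a set meeting all
residues modulo `q`; repeating the dichotomy modulo `p` on that set gives either the gain again or
slope `p + q` directly (`card_dilateSum_ge_of_isSaturated`). Finitely many rounds reach `p + q`. A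
rational linear functional carries the bound to finite sets of reals, and the infimum of the
admissible constants is attained.

For the bound in dimension `d`, factor out the common direction of the lines. The image of `A` spans
dimension `d - 1` and has at most `r` points, whose fibres obey the one-dimensional bound. Induction
removes the fibre over a point `x` minimising a generic functional (`card_dilateSum_ge_of_fibers`).
The extreme rays at `x` supply enough points `y` for which `q • x + s • y` and `q • y + s • x` are
new and distinct, and each such pair of fibres contributes twice by Cauchy–Davenport. This yields
the extra slope `2 * (d - 1)`. -/

/-- The sum `q • X + s • Y` of dilates, as a finset. -/
noncomputable def dilateSum {R M : Type*} [Ring R] [AddCommGroup M] [Module R M] (q s : R)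
    (X Y : Finset M) : Finset M :=
  letI := Classical.decEq M
  Finset.image₂ (fun x y => q • x + s • y) X Y

/-! ### Elementary bounds for sums of dilates. -/

section Basic

variable {R M : Type*} [Ring R] [AddCommGroup M] [Module R M] {q s : R} {X Y X' Y' : Finset M}

theorem mem_dilateSum {z : M} :
    z ∈ dilateSum q s X Y ↔ ∃ x ∈ X, ∃ y ∈ Y, q • x + s • y = z := by
  simp [dilateSum, Finset.mem_image₂]

theorem dilateSum_mono (hX : X ⊆ X') (hY : Y ⊆ Y') :
    dilateSum q s X Y ⊆ dilateSum q s X' Y' := by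
  intro z
  simp only [mem_dilateSum]
  rintro ⟨x, hx, y, hy, rfl⟩
  exact ⟨x, hX hx, y, hY hy, rfl⟩

theorem dilateSum_comm : dilateSum q s X Y = dilateSum s q Y X := by
  ext z
  simp only [mem_dilateSum]
  constructor
  · rintro ⟨x, hx, y, hy, rfl⟩
    exact ⟨y, hy, x, hx, add_comm _ _⟩
  · rintro ⟨x, hx, y, hy, rfl⟩
    exact ⟨y, hy, x, hx, add_comm _ _⟩

theorem card_dilateSum_ge [IsAddTorsionFree M]
    (hq : Function.Injective fun x : M => q • x) (hs : Function.Injective fun x : M => s • x)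
    (hX : X.Nonempty) (hY : Y.Nonempty) :
    X.card + Y.card ≤ (dilateSum q s X Y).card + 1 := by
  classical
  have h := cauchy_davenport_of_isAddTorsionFree (hX.image fun x : M => q • x)
    (hY.image fun x : M => s • x)
  rw [Finset.card_image_of_injective _ hq, Finset.card_image_of_injective _ hs] at h
  have h2 : X.image (fun x : M => q • x) + Y.image (fun x : M => s • x) = dilateSum q s X Y := by
    ext z
    simp [Finset.mem_add, mem_dilateSum]
  rw [h2] at h
  omega

theorem card_le_card_dilateSum_right
    (hs : Function.Injective fun x : M => s • x) (hX : X.Nonempty) :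
    Y.card ≤ (dilateSum q s X Y).card := by
  obtain ⟨x, hx⟩ := hX
  apply Finset.card_le_card_of_injOn (fun y => q • x + s • y)
  · intro y hy
    exact mem_dilateSum.2 ⟨x, hx, y, hy, rfl⟩
  · intro y _ y' _ h
    exact hs (add_left_cancel h)

end Basic

/-! ### Residue classes and normalisation of sets of integers. -/

/-- Affine maps do not decrease the size of sums of dilates of sets of integers. -/
theorem card_dilateSum_le_affine (p q a : ℤ) {g : ℤ} (hg : g ≠ 0) (X : Finset ℤ) :
    (dilateSum p q X X).card
      ≤ (dilateSum p q (X.image fun x => a + g * x) (X.image fun x => a + g * x)).card := by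
  apply Finset.card_le_card_of_injOn (fun z => (p + q) * a + g * z)
  · intro z hz
    obtain ⟨x, hx, y, hy, rfl⟩ := mem_dilateSum.1 hz
    refine mem_dilateSum.2 ⟨_, Finset.mem_image_of_mem _ hx, _, Finset.mem_image_of_mem _ hy, ?_⟩
    simp only [smul_eq_mul]
    ring
  · intro z _ z' _ h
    exact mul_left_cancel₀ hg (add_left_cancel h)

/-- The elements of `A` in the class of `i` modulo `n`. -/
def residueClass (n : ℤ) (A : Finset ℤ) (i : ℤ) : Finset ℤ := A.filter fun x => x % n = i

/-- The residues modulo `n` of the elements of `A`. -/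
def residues (n : ℤ) (A : Finset ℤ) : Finset ℤ := A.image fun x => x % n

theorem mem_residueClass {n i x : ℤ} {A : Finset ℤ} :
    x ∈ residueClass n A i ↔ x ∈ A ∧ x % n = i := by
  simp [residueClass]

theorem residueClass_subset {n i : ℤ} {A : Finset ℤ} : residueClass n A i ⊆ A :=
  Finset.filter_subset _ _

theorem sum_card_residueClass (n : ℤ) (A : Finset ℤ) :
    ∑ i ∈ residues n A, (residueClass n A i).card = A.card :=
  (Finset.card_eq_sum_card_image (fun x => x % n) A).symm

theorem residueClass_nonempty {n i : ℤ} {A : Finset ℤ} (hi : i ∈ residues n A) :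
    (residueClass n A i).Nonempty := by
  obtain ⟨x, hx, rfl⟩ := Finset.mem_image.1 hi
  exact ⟨x, mem_residueClass.2 ⟨hx, rfl⟩⟩

theorem card_residues_le {n : ℤ} (hn : 0 < n) (A : Finset ℤ) : ((residues n A).card : ℤ) ≤ n := by
  have : residues n A ⊆ Finset.Ico 0 n := by
    intro i hi
    obtain ⟨x, hx, rfl⟩ := Finset.mem_image.1 hi
    simp [Int.emod_nonneg x hn.ne', Int.emod_lt_of_pos x hn]
  have := Finset.card_le_card this
  simp at this
  omega

/-- Distinct residue classes modulo `q` of the first summand contribute disjoint parts. -/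
theorem sum_card_dilateSum_le {p q : ℤ} (hpq : IsCoprime p q) (A Y : Finset ℤ) :
    ∑ i ∈ residues q A, (dilateSum p q (residueClass q A i) Y).card
      ≤ (dilateSum p q A Y).card := by
  classical
  rw [← Finset.card_biUnion]
  · apply Finset.card_le_card
    intro z hz
    obtain ⟨i, -, hz⟩ := Finset.mem_biUnion.1 hz
    exact dilateSum_mono residueClass_subset subset_rfl hz
  · intro i _ j _ hij
    change Disjoint _ _
    rw [Finset.disjoint_left]
    intro z hz hz'
    obtain ⟨x, hx, y, -, rfl⟩ := mem_dilateSum.1 hz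
    obtain ⟨x', hx', y', -, h⟩ := mem_dilateSum.1 hz'
    apply hij
    rw [← (mem_residueClass.1 hx).2, ← (mem_residueClass.1 hx').2]
    apply Int.ModEq.symm
    rw [Int.modEq_iff_dvd]
    apply hpq.symm.dvd_of_dvd_mul_left
    simp only [smul_eq_mul] at h
    exact ⟨y' - y, by linear_combination -h⟩

theorem zsmul_injective {q : ℤ} (hq : 0 < q) : Function.Injective fun x : ℤ => q • x := by
  intro x y h
  simpa [hq.ne'] using h

/-- No integer other than `±1` divides all differences of elements of `A`. -/
def HasCoprimeDifferences (A : Finset ℤ) : Prop := ∀ d : ℤ, (∀ a ∈ A, ∀ b ∈ A, d ∣ a - b) → IsUnit d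

/-- Divide the differences from a base point by their gcd. By `card_dilateSum_le_affine`, lower
bounds for the normalised set pass to `A`. -/
theorem exists_hasCoprimeDifferences {A : Finset ℤ} (hA : 2 ≤ A.card) :
    ∃ (a g : ℤ) (A' : Finset ℤ), A = A'.image (fun x => a + g * x) ∧ g ≠ 0 ∧ a ∈ A ∧
      A'.card = A.card ∧ HasCoprimeDifferences A' := by
  obtain ⟨a, ha, b, hb, hab⟩ := Finset.one_lt_card.1 hA
  set g := A.gcd (fun x => x - a) with hg
  have hdvd : ∀ x ∈ A, g ∣ x - a := fun x hx => Finset.gcd_dvd hx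
  have hg0 : g ≠ 0 := by
    intro h0
    have := hdvd b hb
    rw [h0, zero_dvd_iff] at this
    exact hab (by linarith)
  have hinv : ∀ x ∈ A, a + g * ((x - a) / g) = x := by
    intro x hx
    rw [Int.mul_ediv_cancel' (hdvd x hx)]
    ring
  refine ⟨a, g, A.image fun x => (x - a) / g, ?_, hg0, ha, ?_, ?_⟩
  · rw [Finset.image_image]
    ext z
    simp only [Finset.mem_image, Function.comp]
    constructor
    · intro hz
      exact ⟨z, hz, hinv z hz⟩
    · rintro ⟨x, hx, rfl⟩
      rwa [hinv x hx]
  · apply Finset.card_image_of_injOn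
    intro x hx y hy h
    rw [← hinv x hx, ← hinv y hy]
    simp only at h
    rw [h]
  · intro d hd
    have : g * d ∣ g := by
      rw [hg]
      apply Finset.dvd_gcd
      intro x hx
      rw [← hg]
      have := hd _ (Finset.mem_image_of_mem _ hx) _ (Finset.mem_image_of_mem _ ha)
      simp only [sub_self, Int.zero_ediv, sub_zero] at this
      have h2 := mul_dvd_mul_left g this
      rwa [Int.mul_ediv_cancel' (hdvd x hx)] at h2
    have h3 : g * d ∣ g * 1 := by simpa using this
    exact isUnit_of_dvd_one ((mul_dvd_mul_iff_left hg0).1 h3)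

/-! ### Saturation modulo `q ^ 2`. -/

/-- If the residues modulo `q²` of `p • Aᵢ + q • A` all occur already in `p • Aᵢ + q • Aᵢ`, where
`Aᵢ` is a class modulo `q` of a set `A` with coprime differences, then `Aᵢ` meets all classes modulo `q²`
that it can meet. -/
theorem exists_modEq_sq {p q : ℤ} (hq : 0 < q) (hpq : IsCoprime p q) {A : Finset ℤ}
    (hred : HasCoprimeDifferences A) {i a₀ : ℤ} (ha₀ : a₀ ∈ residueClass q A i)
    (hsat : ∀ a ∈ residueClass q A i, ∀ b ∈ A, ∃ a' ∈ residueClass q A i,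
      ∃ b' ∈ residueClass q A i, p * a + q * b ≡ p * a' + q * b' [ZMOD q ^ 2])
    {c : ℤ} (hc : c ≡ i [ZMOD q]) :
    ∃ a ∈ residueClass q A i, a ≡ c [ZMOD q ^ 2] := by
  let S : Set ℤ := {n | ∃ a ∈ residueClass q A i, n ≡ p * a [ZMOD q ^ 2]}
  have hmod : ∀ b ∈ residueClass q A i, ∀ b' ∈ residueClass q A i, q ∣ b - b' := by
    intro b hb b' hb'
    have : b' ≡ b [ZMOD q] := (mem_residueClass.1 hb').2.trans (mem_residueClass.1 hb).2.symm
    exact this.dvd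
  have hstep : ∀ b ∈ A, ∀ n ∈ S, n + q * (b - a₀) ∈ S := by
    rintro b hb n ⟨a, ha, hn⟩
    obtain ⟨a', ha', b', hb', h⟩ := hsat a ha b hb
    refine ⟨a', ha', ?_⟩
    rw [Int.modEq_iff_dvd] at *
    obtain ⟨k, hk⟩ := hn
    obtain ⟨l, hl⟩ := h
    obtain ⟨m, hm⟩ := hmod b' hb' a₀ ha₀
    exact ⟨k + l - m, by linear_combination hk + hl - q * hm⟩
  have hper : ∀ n ∈ S, ∀ k : ℤ, n + q * (q * k) ∈ S := by
    rintro n ⟨a, ha, hn⟩ k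
    refine ⟨a, ha, ?_⟩
    rw [Int.modEq_iff_dvd] at *
    obtain ⟨l, hl⟩ := hn
    exact ⟨l - k, by linear_combination hl⟩
  have hnat : ∀ t : ℤ, (∀ n ∈ S, n + q * t ∈ S) → ∀ k : ℕ, ∀ n ∈ S, n + q * (k * t) ∈ S := by
    intro t ht k
    induction k with
    | zero => intro n hn; simpa using hn
    | succ k ih =>
      intro n hn
      have := ht _ (ih n hn)
      convert this using 1
      push_cast
      ring
  -- The `t` for which `S` is stable under translation by `q * t`. As `S` is `q ^ 2`-periodic, `q -
  -- 1` translations by `q * t` amount to one by `-(q * t)`, so `H` is a group. It contains all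
  -- differences of `A`, hence is all of `ℤ`.
  let H : AddSubgroup ℤ :=
    { carrier := {t | ∀ n ∈ S, n + q * t ∈ S}
      zero_mem' := by intro n hn; simpa using hn
      add_mem' := by
        intro t u ht hu n hn
        have := hu _ (ht n hn)
        convert this using 1
        ring
      neg_mem' := by
        intro t ht n hn
        have h1 := hper _ (hnat t ht (q - 1).toNat n hn) (-t)
        rw [Int.toNat_of_nonneg (by omega)] at h1
        convert h1 using 1
        ring }
  have hH : (1 : ℤ) ∈ H := by
    obtain ⟨d, hd⟩ := Int.subgroup_cyclic H
    have hdu : IsUnit d := by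
      apply hred
      intro a ha b hb
      have h1 : a - a₀ ∈ H := hstep a ha
      have h2 : b - a₀ ∈ H := hstep b hb
      have h3 := H.sub_mem h1 h2
      rw [hd, AddSubgroup.mem_closure_singleton] at h3
      obtain ⟨k, hk⟩ := h3
      exact ⟨k, by rw [smul_eq_mul] at hk; linarith⟩
    rw [hd, AddSubgroup.mem_closure_singleton]
    obtain ⟨k, hk⟩ := hdu.dvd (a := 1)
    exact ⟨k, by rw [smul_eq_mul]; linarith⟩
  have hi : a₀ ≡ c [ZMOD q] := by
    have h1 : a₀ % q = i := (mem_residueClass.1 ha₀).2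
    rw [← h1] at hc
    exact (hc.trans (Int.mod_modEq _ _)).symm
  obtain ⟨k, hk⟩ := hi.dvd
  have hp0 : p * a₀ ∈ S := ⟨a₀, ha₀, Int.ModEq.refl _⟩
  have hk' : p * k ∈ H := by
    have := H.zsmul_mem hH (p * k)
    simpa using this
  -- With `c = a₀ + q * k`, translating `p * a₀` by `q * (p * k)` lands on `p * c`; then `p` cancels
  -- modulo `q ^ 2`.
  obtain ⟨a, ha, h⟩ := hk' _ hp0
  refine ⟨a, ha, ?_⟩
  rw [Int.modEq_iff_dvd] at *
  have hcop : IsCoprime (q ^ 2) p := (hpq.pow_right).symm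
  apply hcop.dvd_of_dvd_mul_left
  rw [← Int.modEq_iff_dvd] at *
  have : p * (c - a) = -(p * a - (p * a₀ + q * (p * k))) := by linear_combination p * hk
  rw [this, dvd_neg]
  exact h.dvd

/-- Every class modulo `q` met by `A` has all its subclasses modulo `q²` met by `A`. -/
def IsSaturated (q : ℤ) (A : Finset ℤ) : Prop :=
  ∀ i ∈ residues q A, ∀ c : ℤ, c ≡ i [ZMOD q] → ∃ a ∈ residueClass q A i, a ≡ c [ZMOD q ^ 2]

/-- By `exists_modEq_sq`, some `p * a + q * b` has a residue modulo `q ^ 2` missed by the sums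
within the class of `i`. Letting `b` vary in its class modulo `q` keeps that residue, so the whole
class yields new sums. -/
theorem card_add_card_le_of_not_isSaturated {p q : ℤ} (hq : 0 < q) (hpq : IsCoprime p q)
    {A : Finset ℤ} (hred : HasCoprimeDifferences A) (hsat : ¬ IsSaturated q A) :
    ∃ i ∈ residues q A, ∃ k ∈ residues q A,
      (dilateSum p q (residueClass q A i) (residueClass q A i)).card + (residueClass q A k).card
        ≤ (dilateSum p q (residueClass q A i) A).card := by
  classical
  unfold IsSaturated at hsat
  push Not at hsat
  obtain ⟨i, hi, c, hc, hno⟩ := hsat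
  obtain ⟨a₀, ha₀⟩ := residueClass_nonempty hi
  have : ∃ a ∈ residueClass q A i, ∃ b ∈ A, ∀ a' ∈ residueClass q A i,
      ∀ b' ∈ residueClass q A i, ¬ p * a + q * b ≡ p * a' + q * b' [ZMOD q ^ 2] := by
    by_contra hcon
    push Not at hcon
    obtain ⟨a, ha, h⟩ := exists_modEq_sq hq hpq hred ha₀ hcon hc
    exact hno a ha h
  obtain ⟨a, ha, b, hb, hab⟩ := this
  refine ⟨i, hi, b % q, Finset.mem_image_of_mem _ hb, ?_⟩
  rw [← Finset.card_image_of_injective (residueClass q A (b % q))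
    (f := fun x => p * a + q * x), ← Finset.card_union_of_disjoint]
  · apply Finset.card_le_card
    apply Finset.union_subset
    · exact dilateSum_mono subset_rfl residueClass_subset
    · intro z hz
      obtain ⟨x, hx, rfl⟩ := Finset.mem_image.1 hz
      exact mem_dilateSum.2 ⟨a, ha, x, residueClass_subset hx, by simp⟩
  · rw [Finset.disjoint_left]
    intro z hz hz'
    obtain ⟨x, hx, rfl⟩ := Finset.mem_image.1 hz'
    obtain ⟨a', ha', b', hb', h⟩ := mem_dilateSum.1 hz
    apply hab a' ha' b' hb'
    simp only [smul_eq_mul] at h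
    rw [h, Int.modEq_iff_dvd]
    have hx2 : b ≡ x [ZMOD q] := (mem_residueClass.1 hx).2.symm
    obtain ⟨k, hk⟩ := hx2.dvd
    exact ⟨k, by linear_combination q * hk⟩
  · intro x y h
    simp only at h
    have : q * x = q * y := by linarith
    exact mul_left_cancel₀ hq.ne' this

/-! ### Raising the slope for sets of integers. -/

theorem improved_bound_or_isSaturated {p q : ℤ} (hq : 0 < q) (hpq : IsCoprime p q)
    {m C δ : ℝ} (hm : 0 ≤ m) (hC : 0 ≤ C) (hmδ : (m + 1) * δ ≤ 1)
    (H : ∀ A : Finset ℤ, m * A.card - C ≤ (dilateSum p q A A).card)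
    {A : Finset ℤ} (hred : HasCoprimeDifferences A) :
    (m + δ) * A.card - q * C ≤ (dilateSum p q A A).card ∨ IsSaturated q A := by
  classical
  by_cases hsat : IsSaturated q A
  · exact Or.inr hsat
  left
  have hbase : ∀ i, m * (residueClass q A i).card - C
      ≤ (dilateSum p q (residueClass q A i) A).card := by
    intro i
    refine (H _).trans ?_
    exact_mod_cast Finset.card_le_card (dilateSum_mono subset_rfl residueClass_subset)
  obtain ⟨i₀, hi₀, hgain⟩ : ∃ i ∈ residues q A, m * (residueClass q A i).card + δ * A.card - C
      ≤ (dilateSum p q (residueClass q A i) A).card := by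
    -- A class smaller than `δ * A.card` gains because its sum with `A` has at least `A.card ≥ (m +
    -- 1) * δ * A.card` elements. If there is none, the extra class gained from non-saturation has
    -- size at least `δ * A.card`.
    by_cases hsmall : ∃ k ∈ residues q A, ((residueClass q A k).card : ℝ) < δ * A.card
    · obtain ⟨k, hk, hlt⟩ := hsmall
      refine ⟨k, hk, ?_⟩
      have h1 : (A.card : ℝ) ≤ (dilateSum p q (residueClass q A k) A).card := by
        exact_mod_cast card_le_card_dilateSum_right (zsmul_injective hq)
          (residueClass_nonempty hk)
      have h2 := mul_le_mul_of_nonneg_left hlt.le hm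
      have h3 : (m + 1) * δ * A.card ≤ 1 * A.card :=
        mul_le_mul_of_nonneg_right hmδ (Nat.cast_nonneg _)
      linarith
    · push Not at hsmall
      obtain ⟨i, hi, k, hk, h⟩ := card_add_card_le_of_not_isSaturated hq hpq hred hsat
      refine ⟨i, hi, ?_⟩
      have h1 := H (residueClass q A i)
      have h2 := hsmall k hk
      have h3 : ((dilateSum p q (residueClass q A i) (residueClass q A i)).card : ℝ)
        + (residueClass q A k).card ≤ (dilateSum p q (residueClass q A i) A).card := by
        exact_mod_cast h
      linarith
  have h1 : (∑ i ∈ residues q A, ((dilateSum p q (residueClass q A i) A).card : ℝ))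
      ≤ (dilateSum p q A A).card := by
    exact_mod_cast sum_card_dilateSum_le hpq A A
  have h2 : ∑ i ∈ residues q A, (m * ((residueClass q A i).card : ℝ) - C)
      + δ * A.card ≤ ∑ i ∈ residues q A, ((dilateSum p q (residueClass q A i) A).card : ℝ) := by
    rw [← Finset.add_sum_erase _ _ hi₀,
      ← Finset.add_sum_erase _ (fun i => ((dilateSum p q (residueClass q A i) A).card : ℝ)) hi₀]
    have := Finset.sum_le_sum fun i (_ : i ∈ (residues q A).erase i₀) => hbase i
    linarith
  rw [Finset.sum_sub_distrib, ← Finset.mul_sum, Finset.sum_const, nsmul_eq_mul] at h2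
  have h3 : (∑ i ∈ residues q A, ((residueClass q A i).card : ℝ)) = A.card := by
    exact_mod_cast sum_card_residueClass q A
  have h4 : ((residues q A).card : ℝ) * C ≤ q * C := by
    apply mul_le_mul_of_nonneg_right _ hC
    exact_mod_cast card_residues_le hq A
  rw [h3] at h2
  linarith

/-- All of `p • D` lies in one class modulo `p ^ 2`, so the pieces of the `j`-class modulo `p ^ 2`
give disjoint sums. Saturation provides at least `p` pieces, and each sum obeys the Cauchy–Davenport
bound. -/
theorem card_dilateSum_ge_of_isSaturated_right {p q : ℤ} (hp : 0 < p) (hq : 0 < q)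
    (hpq : IsCoprime p q) {A D : Finset ℤ} {j h : ℤ} (hj : j ∈ residues p A)
    (hsat : IsSaturated p A) (hD : D.Nonempty) (hDh : ∀ x ∈ D, x % p = h) :
    p * D.card + (residueClass p A j).card
      ≤ ((dilateSum p q D (residueClass p A j)).card : ℤ) + p := by
  classical
  set B := residueClass p A j with hB
  have hsum : ∑ c ∈ residues (p ^ 2) B, (dilateSum p q D (residueClass (p ^ 2) B c)).card
      ≤ (dilateSum p q D B).card := by
    rw [← Finset.card_biUnion]
    · apply Finset.card_le_card
      intro z hz
      obtain ⟨i, -, hz⟩ := Finset.mem_biUnion.1 hz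
      exact dilateSum_mono subset_rfl residueClass_subset hz
    · intro c _ c' _ hcc
      change Disjoint _ _
      rw [Finset.disjoint_left]
      intro z hz hz'
      obtain ⟨x, hx, y, hy, rfl⟩ := mem_dilateSum.1 hz
      obtain ⟨x', hx', y', hy', e⟩ := mem_dilateSum.1 hz'
      apply hcc
      rw [← (mem_residueClass.1 hy).2, ← (mem_residueClass.1 hy').2]
      apply Int.ModEq.symm
      rw [Int.modEq_iff_dvd]
      have hcop : IsCoprime (p ^ 2) q := hpq.pow_left
      apply hcop.dvd_of_dvd_mul_left
      have hxx : x ≡ x' [ZMOD p] := (hDh x hx).trans (hDh x' hx').symm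
      obtain ⟨k, hk⟩ := hxx.dvd
      simp only [smul_eq_mul] at e
      exact ⟨k, by linear_combination p * hk - e⟩
  have hN : p.toNat ≤ (residues (p ^ 2) B).card := by
    have hjj : ∀ k ∈ Finset.range p.toNat, (j + p * (k : ℤ)) % p ^ 2 ∈ residues (p ^ 2) B := by
      intro k _
      obtain ⟨a, ha, hak⟩ := hsat j hj (j + p * k) (by simp [Int.ModEq])
      exact Finset.mem_image.2 ⟨a, ha, hak⟩
    have hinj : Set.InjOn (fun k : ℕ => (j + p * (k : ℤ)) % p ^ 2)
        (Finset.range p.toNat : Set ℕ) := by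
      intro k hk l hl e
      have e' : j + p * (k : ℤ) ≡ j + p * (l : ℤ) [ZMOD p ^ 2] := e
      obtain ⟨t, ht⟩ := e'.dvd
      have h1 : (l : ℤ) - k = p * t := by
        apply mul_left_cancel₀ hp.ne'
        linear_combination ht
      have hk2 : (k : ℤ) < p := by
        have := Finset.mem_range.1 hk
        omega
      have hl2 : (l : ℤ) < p := by
        have := Finset.mem_range.1 hl
        omega
      have h2 : (l : ℤ) - k = 0 := by
        apply Int.eq_zero_of_abs_lt_dvd ⟨t, h1⟩
        rw [abs_lt]
        constructor <;> omega
      omega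
    simpa using Finset.card_le_card_of_injOn _ hjj hinj
  have hterm : ∀ c ∈ residues (p ^ 2) B, ((D.card : ℤ) - 1) + (residueClass (p ^ 2) B c).card
      ≤ (dilateSum p q D (residueClass (p ^ 2) B c)).card := by
    intro c hc
    have := card_dilateSum_ge (q := p) (s := q) (zsmul_injective hp) (zsmul_injective hq) hD
      (residueClass_nonempty hc)
    omega
  have h1 := Finset.sum_le_sum hterm
  rw [Finset.sum_add_distrib, Finset.sum_const, nsmul_eq_mul] at h1
  have h2 : ∑ c ∈ residues (p ^ 2) B, ((residueClass (p ^ 2) B c).card : ℤ) = B.card := by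
    exact_mod_cast sum_card_residueClass (p ^ 2) B
  have h3 : ∑ c ∈ residues (p ^ 2) B, ((dilateSum p q D (residueClass (p ^ 2) B c)).card : ℤ)
      ≤ (dilateSum p q D B).card := by exact_mod_cast hsum
  have h4 : p * ((D.card : ℤ) - 1) ≤ (residues (p ^ 2) B).card * ((D.card : ℤ) - 1) := by
    have := hD.card_pos
    apply mul_le_mul_of_nonneg_right _ (by omega)
    omega
  rw [h2] at h1
  linarith

/-- Split the first summand modulo `q` and the second modulo `p`. In cell `(i, j)` take `D` to be
the intersection of the two classes: summing `p * D.card` gives `p * A.card`, while the second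
classes are counted once for each of the exactly `q` residues `i`. -/
theorem card_dilateSum_ge_of_isSaturated {p q : ℤ} (hp : 0 < p) (hq : 0 < q)
    (hpq : IsCoprime p q) {A : Finset ℤ} (hA : ∀ c : ℤ, ∃ a ∈ A, a ≡ c [ZMOD q])
    (hsat : IsSaturated p A) :
    (p + q) * (A.card : ℤ) - p * (p * q) ≤ (dilateSum p q A A).card := by
  classical
  have hterm : ∀ i ∈ residues q A, ∀ j ∈ residues p A,
      p * ((residueClass p (residueClass q A i) j).card : ℤ) + (residueClass p A j).card - p
        ≤ (dilateSum p q (residueClass q A i) (residueClass p A j)).card := by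
    intro i hi j hj
    rcases (residueClass p (residueClass q A i) j).eq_empty_or_nonempty with h0 | h0
    · have := card_le_card_dilateSum_right (q := p) (s := q) (Y := residueClass p A j)
        (zsmul_injective hq) (residueClass_nonempty hi)
      rw [h0]
      simp only [Finset.card_empty]
      push_cast
      omega
    · have h1 := card_dilateSum_ge_of_isSaturated_right hp hq hpq hj hsat h0
        (fun x hx => (mem_residueClass.1 hx).2)
      have h2 := Finset.card_le_card (dilateSum_mono (q := p) (s := q)
        (residueClass_subset (n := p) (i := j) (A := residueClass q A i))
        (subset_refl (residueClass p A j)))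
      omega
  have hres : ((residues q A).card : ℤ) = q := by
    apply le_antisymm (card_residues_le hq A)
    have : Finset.Ico 0 q ⊆ residues q A := by
      intro c hc
      rw [Finset.mem_Ico] at hc
      obtain ⟨a, ha, hac⟩ := hA c
      refine Finset.mem_image.2 ⟨a, ha, ?_⟩
      rw [hac.eq, Int.emod_eq_of_lt hc.1 hc.2]
    have := Finset.card_le_card this
    simp at this
    omega
  have hrow : ∀ i ∈ residues q A,
      p * ((residueClass q A i).card : ℤ) + A.card - p * p
        ≤ (dilateSum p q (residueClass q A i) A).card := by
    intro i hi
    have h1 := Finset.sum_le_sum (hterm i hi)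
    rw [Finset.sum_sub_distrib, Finset.sum_add_distrib, ← Finset.mul_sum, Finset.sum_const,
      nsmul_eq_mul] at h1
    have h2 : ∑ j ∈ residues p A, ((residueClass p A j).card : ℤ) = A.card := by
      exact_mod_cast sum_card_residueClass p A
    have h3 : ((residueClass q A i).card : ℤ)
        ≤ ∑ j ∈ residues p A, ((residueClass p (residueClass q A i) j).card : ℤ) := by
      rw [← sum_card_residueClass p (residueClass q A i)]
      push_cast
      apply Finset.sum_le_sum_of_subset_of_nonneg
      · exact Finset.image_subset_image residueClass_subset
      · intros
        positivity
    have h4 : ∑ j ∈ residues p A,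
        ((dilateSum p q (residueClass q A i) (residueClass p A j)).card : ℤ)
        ≤ (dilateSum p q (residueClass q A i) A).card := by
      have := sum_card_dilateSum_le hpq.symm A (residueClass q A i)
      simp only [dilateSum_comm (q := q) (s := p)] at this
      exact_mod_cast this
    have h5 := card_residues_le hp A
    have h6 := mul_le_mul_of_nonneg_right h5 hp.le
    have h7 := mul_le_mul_of_nonneg_left h3 hp.le
    linarith
  have h1 := Finset.sum_le_sum hrow
  rw [Finset.sum_sub_distrib, Finset.sum_add_distrib, ← Finset.mul_sum, Finset.sum_const,
    Finset.sum_const, nsmul_eq_mul, nsmul_eq_mul, hres] at h1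
  have h2 : ∑ i ∈ residues q A, ((residueClass q A i).card : ℤ) = A.card := by
    exact_mod_cast sum_card_residueClass q A
  have h3 : ∑ i ∈ residues q A, ((dilateSum p q (residueClass q A i) A).card : ℤ)
      ≤ (dilateSum p q A A).card := by
    exact_mod_cast sum_card_dilateSum_le hpq A A
  rw [h2] at h1
  linarith

theorem improved_bound_of_surjective {p q : ℤ} (hp : 0 < p) (hq : 0 < q) (hpq : IsCoprime p q)
    {m C δ M : ℝ} (hm : 0 ≤ m) (hC : 0 ≤ C) (hmδ : (m + 1) * δ ≤ 1) (hM : 0 ≤ M)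
    (hMm : M ≤ m + δ) (hMpq : M ≤ p + q)
    (H : ∀ A : Finset ℤ, m * A.card - C ≤ (dilateSum p q A A).card)
    {A : Finset ℤ} (hA : ∀ c : ℤ, ∃ a ∈ A, a ≡ c [ZMOD q]) :
    M * A.card - (p * C + p * (p * q) + M) ≤ (dilateSum p q A A).card := by
  have hp' : (0 : ℝ) < p := by exact_mod_cast hp
  have hq' : (0 : ℝ) < q := by exact_mod_cast hq
  have hpC : 0 ≤ p * C := by positivity
  have hppq : (0 : ℝ) ≤ p * (p * q) := by positivity
  rcases le_or_gt A.card 1 with h1 | h2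
  · have h1' : (A.card : ℝ) ≤ 1 := by exact_mod_cast h1
    have h0 : (0 : ℝ) ≤ (dilateSum p q A A).card := Nat.cast_nonneg _
    nlinarith
  obtain ⟨a, g, A', hAA', hg, ha, hcard, hred⟩ := exists_hasCoprimeDifferences h2
  have hle : ((dilateSum p q A' A').card : ℝ) ≤ (dilateSum p q A A).card := by
    rw [hAA']
    exact_mod_cast card_dilateSum_le_affine p q a hg A'
  refine le_trans ?_ hle
  rw [← hcard]
  have hc0 : (0 : ℝ) ≤ A'.card := Nat.cast_nonneg _
  have hMA := mul_le_mul_of_nonneg_right hMm hc0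
  have hMA' := mul_le_mul_of_nonneg_right hMpq hc0
  have hsurj : ∀ c : ℤ, ∃ x ∈ A', x ≡ c [ZMOD q] := by
    have hmem : ∀ c : ℤ, ∃ x ∈ A', q ∣ a + c - (a + g * x) := by
      intro c
      obtain ⟨b, hb, hbc⟩ := hA (a + c)
      rw [hAA'] at hb
      obtain ⟨x, hx, rfl⟩ := Finset.mem_image.1 hb
      exact ⟨x, hx, hbc.dvd⟩
    -- Since `A` meets every class modulo `q`, the normalising factor `g` is invertible modulo `q`,
    -- so `A'` meets every class too.
    have hgq : IsCoprime q g := by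
      obtain ⟨x, -, k, hk⟩ := hmem 1
      exact ⟨k, x, by linear_combination -hk⟩
    intro c
    obtain ⟨x, hx, hk⟩ := hmem (g * c)
    refine ⟨x, hx, ?_⟩
    rw [Int.modEq_iff_dvd]
    apply hgq.dvd_of_dvd_mul_left
    have e : g * (c - x) = a + g * c - (a + g * x) := by ring
    rwa [e]
  -- The dichotomy is used here with the two coefficients exchanged, giving saturation modulo `p`.
  rcases improved_bound_or_isSaturated (p := q) (q := p) hp hpq.symm hm hC hmδ
    (fun A => by rw [dilateSum_comm]; exact H A) hred with h | h
  · rw [dilateSum_comm] at h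
    linarith
  · have := card_dilateSum_ge_of_isSaturated hp hq hpq hsurj h
    have : ((p : ℝ) + q) * A'.card - p * (p * q) ≤ (dilateSum p q A' A').card := by
      exact_mod_cast this
    linarith

theorem residueClass_eq_image (q : ℤ) (A : Finset ℤ) (i : ℤ) :
    residueClass q A i
      = ((residueClass q A i).image fun x => x / q).image fun x => i + q * x := by
  have key : ∀ x ∈ residueClass q A i, i + q * (x / q) = x := by
    intro x hx
    rw [← (mem_residueClass.1 hx).2]
    exact Int.emod_add_mul_ediv x q
  rw [Finset.image_image]
  ext z
  simp only [Finset.mem_image, Function.comp]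
  constructor
  · intro hz
    exact ⟨z, hz, key z hz⟩
  · rintro ⟨x, hx, rfl⟩
    rwa [key x hx]

/-- One round of the bootstrap. In the saturated case each class is `i + q * B` with `B` meeting all
residues modulo `q`, so `improved_bound_of_surjective` applies class by class, and there are at most
`q` classes. -/
theorem improved_bound {p q : ℤ} (hp : 0 < p) (hq : 0 < q) (hpq : IsCoprime p q)
    {m C δ M : ℝ} (hm : 0 ≤ m) (hC : 0 ≤ C) (hmδ : (m + 1) * δ ≤ 1) (hM : 0 ≤ M)
    (hMm : M ≤ m + δ) (hMpq : M ≤ p + q)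
    (H : ∀ A : Finset ℤ, m * A.card - C ≤ (dilateSum p q A A).card) :
    ∃ C' : ℝ, 0 ≤ C' ∧ ∀ A : Finset ℤ, M * A.card - C' ≤ (dilateSum p q A A).card := by
  have hp' : (0 : ℝ) < p := by exact_mod_cast hp
  have hq' : (0 : ℝ) < q := by exact_mod_cast hq
  obtain ⟨C₁, hC₁⟩ : ∃ C₁, C₁ = p * C + p * (p * q) + M := ⟨_, rfl⟩
  have hC₁0 : 0 ≤ C₁ := by rw [hC₁]; positivity
  have hqC : 0 ≤ q * C := by positivity
  have hqC₁ : 0 ≤ q * C₁ := by positivity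
  refine ⟨q * C + q * C₁ + M, by positivity, fun A => ?_⟩
  rcases le_or_gt A.card 1 with h1 | h2
  · have h1' : (A.card : ℝ) ≤ 1 := by exact_mod_cast h1
    have h0 : (0 : ℝ) ≤ (dilateSum p q A A).card := Nat.cast_nonneg _
    nlinarith
  obtain ⟨a, g, A', hAA', hg, ha, hcard, hred⟩ := exists_hasCoprimeDifferences h2
  have hle : ((dilateSum p q A' A').card : ℝ) ≤ (dilateSum p q A A).card := by
    rw [hAA']
    exact_mod_cast card_dilateSum_le_affine p q a hg A'
  refine le_trans ?_ hle
  rw [← hcard]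
  have hMA := mul_le_mul_of_nonneg_right hMm (Nat.cast_nonneg (α := ℝ) A'.card)
  rcases improved_bound_or_isSaturated hq hpq hm hC hmδ H hred with h | h
  · linarith
  have hterm : ∀ i ∈ residues q A', M * ((residueClass q A' i).card : ℝ) - C₁
      ≤ (dilateSum p q (residueClass q A' i) A').card := by
    intro i hi
    set B := (residueClass q A' i).image fun x => x / q with hB
    have hBi : residueClass q A' i = B.image fun x => i + q * x := residueClass_eq_image q A' i
    have hsurj : ∀ c : ℤ, ∃ x ∈ B, x ≡ c [ZMOD q] := by
      intro c
      obtain ⟨b, hb, hbc⟩ := h i hi (i + q * c) (by simp [Int.ModEq])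
      rw [hBi] at hb
      obtain ⟨x, hx, rfl⟩ := Finset.mem_image.1 hb
      refine ⟨x, hx, ?_⟩
      obtain ⟨k, hk⟩ := hbc.dvd
      rw [Int.modEq_iff_dvd]
      exact ⟨k, mul_left_cancel₀ hq.ne' (by linear_combination hk)⟩
    have h1 := improved_bound_of_surjective hp hq hpq hm hC hmδ hM hMm hMpq H hsurj
    have h2 : (residueClass q A' i).card = B.card := by
      rw [hBi]
      apply Finset.card_image_of_injective
      intro x y hxy
      exact mul_left_cancel₀ hq.ne' (add_left_cancel hxy)
    have h3 : ((dilateSum p q B B).card : ℝ) ≤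
        (dilateSum p q (residueClass q A' i) (residueClass q A' i)).card := by
      rw [hBi]
      exact_mod_cast card_dilateSum_le_affine p q i hq.ne' B
    have h4 : ((dilateSum p q (residueClass q A' i) (residueClass q A' i)).card : ℝ)
        ≤ (dilateSum p q (residueClass q A' i) A').card := by
      exact_mod_cast Finset.card_le_card (dilateSum_mono subset_rfl residueClass_subset)
    rw [h2, hC₁]
    linarith
  have h1 := Finset.sum_le_sum hterm
  rw [Finset.sum_sub_distrib, ← Finset.mul_sum, Finset.sum_const, nsmul_eq_mul] at h1
  have h2 : ∑ i ∈ residues q A', ((residueClass q A' i).card : ℝ) = A'.card := by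
    exact_mod_cast sum_card_residueClass q A'
  have h3 : ∑ i ∈ residues q A', ((dilateSum p q (residueClass q A' i) A').card : ℝ)
      ≤ (dilateSum p q A' A').card := by
    exact_mod_cast sum_card_dilateSum_le hpq A' A'
  have h4 : ((residues q A').card : ℝ) * C₁ ≤ q * C₁ := by
    apply mul_le_mul_of_nonneg_right _ hC₁0
    exact_mod_cast card_residues_le hq A'
  rw [h2] at h1
  linarith

theorem exists_bound_card_dilateSum_int {p q : ℤ} (hp : 0 < p) (hq : 0 < q)
    (hpq : IsCoprime p q) :
    ∃ C : ℝ, ∀ A : Finset ℤ, ((p : ℝ) + q) * A.card - C ≤ (dilateSum p q A A).card := by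
  have hp' : (0 : ℝ) < p := by exact_mod_cast hp
  have hq' : (0 : ℝ) < q := by exact_mod_cast hq
  set T : ℝ := p + q with hT
  have hT0 : 0 < T := by positivity
  set δ : ℝ := 1 / (T + 1) with hδ
  have hδ0 : 0 < δ := by positivity
  -- The slope never exceeds `T`, so the same `δ = 1 / (T + 1)` serves in every round.
  have key : ∀ n : ℕ, ∃ C : ℝ, 0 ≤ C ∧
      ∀ A : Finset ℤ, min (n * δ) T * A.card - C ≤ (dilateSum p q A A).card := by
    intro n
    induction n with
    | zero => exact ⟨0, le_rfl, fun A => by simp [hT0.le]⟩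
    | succ n ih =>
      obtain ⟨C, hC, H⟩ := ih
      refine improved_bound (δ := δ) hp hq hpq (by positivity) hC ?_ (by positivity) ?_
        (min_le_right _ _) H
      · have h1 : min (n * δ) T + 1 ≤ T + 1 := by gcongr; exact min_le_right _ _
        calc _ ≤ (T + 1) * δ := by gcongr
          _ = 1 := by rw [hδ]; field_simp
      · push_cast
        rw [← min_add_add_right]
        apply min_le_min
        · linarith
        · linarith
  obtain ⟨n, hn⟩ := exists_nat_ge (T / δ)
  obtain ⟨C, -, H⟩ := key n
  refine ⟨C, fun A => ?_⟩
  have := H A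
  rwa [min_eq_right] at this
  rwa [div_le_iff₀ hδ0] at hn

/-! ### From integers to reals, and the least constant. -/

/-- Some rational linear functional is integral and injective on a given finite set of reals. -/
theorem exists_additive_injOn_int (B : Finset ℝ) :
    ∃ (f : ℝ →ₗ[ℚ] ℚ) (g : ℝ → ℤ), (∀ x ∈ B, (g x : ℚ) = f x) ∧ Set.InjOn g B := by
  classical
  obtain ⟨f, hf⟩ := Module.exists_dual_forall_apply_ne_zero (K := ℚ)
    (fun z : B.offDiag => (z : ℝ × ℝ).1 - (z : ℝ × ℝ).2) (by
      rintro ⟨⟨x, y⟩, h⟩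
      have := (Finset.mem_offDiag.1 h).2.2
      exact sub_ne_zero.2 this)
  obtain ⟨⟨b, hb⟩, hbB⟩ := IsLocalization.exist_integer_multiples_of_finset (nonZeroDivisors ℤ)
    (B.image f)
  have hb0 : b ≠ 0 := nonZeroDivisors.ne_zero hb
  have hbB' : ∀ x ∈ B, ∃ n : ℤ, (n : ℚ) = b * f x := by
    intro x hx
    obtain ⟨n, hn⟩ := hbB (f x) (Finset.mem_image_of_mem _ hx)
    exact ⟨n, by simpa using hn⟩
  choose! g hg using hbB'
  refine ⟨(b : ℚ) • f, g, fun x hx => by rw [hg x hx]; simp, ?_⟩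
  intro x hx y hy h
  by_contra hxy
  apply hf ⟨(x, y), Finset.mem_offDiag.2 ⟨hx, hy, hxy⟩⟩
  have h1 : (b : ℚ) * f x = b * f y := by rw [← hg x hx, ← hg y hy, h]
  have h2 : f x = f y := mul_left_cancel₀ (by exact_mod_cast hb0) h1
  simp [map_sub, h2]

theorem coe_dilateSum {R M : Type*} [Ring R] [AddCommGroup M] [Module R M] (q s : R)
    (X Y : Finset M) : (dilateSum q s X Y : Set M) = q • (X : Set M) + s • (Y : Set M) := by
  ext z
  simp only [Finset.mem_coe, mem_dilateSum, Set.mem_add, Set.mem_smul_set]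
  constructor
  · rintro ⟨x, hx, y, hy, rfl⟩
    exact ⟨_, ⟨x, hx, rfl⟩, _, ⟨y, hy, rfl⟩, rfl⟩
  · rintro ⟨_, ⟨x, hx, rfl⟩, _, ⟨y, hy, rfl⟩, rfl⟩
    exact ⟨x, hx, y, hy, rfl⟩

theorem exists_isDilateConst_of_pos {p q : ℤ} (hp : 0 < p) (hq : 0 < q) (hpq : IsCoprime p q) :
    ∃ C, IsDilateConst p q C := by
  classical
  obtain ⟨C, hC⟩ := exists_bound_card_dilateSum_int hp hq hpq
  refine ⟨C, fun B hB => ?_⟩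
  lift B to Finset ℝ using hB
  have hp' : (0 : ℝ) < p := by exact_mod_cast hp
  have hq' : (0 : ℝ) < q := by exact_mod_cast hq
  rw [← coe_dilateSum, Set.ncard_coe_finset, Set.ncard_coe_finset, abs_of_pos hp', abs_of_pos hq']
  obtain ⟨f, g, hfg, hinj⟩ := exists_additive_injOn_int B
  have h1 := hC (B.image g)
  rw [Finset.card_image_of_injOn hinj] at h1
  refine h1.trans ?_
  have hf : ∀ x y : ℝ, f ((p : ℝ) • x + (q : ℝ) • y) = p * f x + q * f y := by
    intro x y
    have h1 : (p : ℝ) • x + (q : ℝ) • y = (p : ℚ) • x + (q : ℚ) • y := by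
      simp [Rat.smul_def]
    rw [h1, map_add, map_smul, map_smul, smul_eq_mul, smul_eq_mul]
  -- `f` commutes with the integer dilations and agrees with `g` on `B`, so every sum for `B.image
  -- g` is the `f`-image of a sum for `B`.
  have h2 : (dilateSum p q (B.image g) (B.image g)).image (fun n : ℤ => (n : ℚ))
      ⊆ (dilateSum (p : ℝ) (q : ℝ) B B).image f := by
    intro z hz
    obtain ⟨w, hw, rfl⟩ := Finset.mem_image.1 hz
    simp only [mem_dilateSum, Finset.mem_image] at hw
    obtain ⟨_, ⟨x, hx, rfl⟩, _, ⟨y, hy, rfl⟩, rfl⟩ := hw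
    refine Finset.mem_image.2 ⟨_, mem_dilateSum.2 ⟨x, hx, y, hy, rfl⟩, ?_⟩
    rw [hf, ← hfg x hx, ← hfg y hy]
    simp
  have h3 := (Finset.card_le_card h2).trans Finset.card_image_le
  rw [Finset.card_image_of_injective _ Int.cast_injective] at h3
  exact_mod_cast h3

theorem ncard_neg_smul_add_neg_smul {M : Type*} [AddCommGroup M] [Module ℝ M] (q s : ℝ)
    (B : Set M) : ((-q) • B + (-s) • B).ncard = (q • B + s • B).ncard := by
  rw [Set.neg_smul_set, Set.neg_smul_set, ← neg_add, ← Set.image_neg_eq_neg,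
    Set.ncard_image_of_injective _ neg_injective]

theorem isDilateConst_neg {q s : ℤ} {C : ℝ} :
    IsDilateConst (-q) (-s) C ↔ IsDilateConst q s C := by
  simp only [IsDilateConst, Int.cast_neg, abs_neg, ncard_neg_smul_add_neg_smul]

theorem pos_or_neg_of_one_lt_mul {q s : ℤ} (hqs : 1 < q * s) :
    (0 < q ∧ 0 < s) ∨ (0 < -q ∧ 0 < -s) := by
  rcases pos_and_pos_or_neg_and_neg_of_mul_pos (zero_lt_one.trans hqs) with h | h
  · exact Or.inl h
  · exact Or.inr ⟨neg_pos.2 h.1, neg_pos.2 h.2⟩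

theorem exists_isDilateConst {q s : ℤ} (hcop : IsCoprime q s) (hqs : 1 < q * s) :
    ∃ C, IsDilateConst q s C := by
  rcases pos_or_neg_of_one_lt_mul hqs with ⟨hq, hs⟩ | ⟨hq, hs⟩
  · exact exists_isDilateConst_of_pos hq hs hcop
  · obtain ⟨C, hC⟩ := exists_isDilateConst_of_pos hq hs hcop.neg_neg
    exact ⟨C, isDilateConst_neg.1 hC⟩

theorem IsDilateConst.nonneg {q s : ℤ} {C : ℝ} (h : IsDilateConst q s C) : 0 ≤ C := by
  have := h ∅ Set.finite_empty
  simpa using this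

theorem isLeast_dilateConst {q s : ℤ} (hcop : IsCoprime q s) (hqs : 1 < q * s) :
    IsLeast {C : ℝ | IsDilateConst q s C} (dilateConst q s) := by
  have hne : {C : ℝ | IsDilateConst q s C}.Nonempty := exists_isDilateConst hcop hqs
  have hbdd : BddBelow {C : ℝ | IsDilateConst q s C} := ⟨0, fun C hC => hC.nonneg⟩
  refine ⟨fun B hB => ?_, fun C hC => csInf_le hbdd hC⟩
  rw [sub_le_comm]
  apply le_csInf hne
  intro C hC
  have := hC B hB
  linarith

/-! ### Extreme rays of finitely generated cones. -/

section Cone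

open scoped NNReal

variable {V : Type*} [AddCommGroup V] [Module ℝ V]

theorem nonneg_and_eq_zero_of_mem_span_nnreal {S : Set V} {φ : V →ₗ[ℝ] ℝ}
    (hφ : ∀ y ∈ S, 0 < φ y) {z : V} (hz : z ∈ Submodule.span ℝ≥0 S) :
    0 ≤ φ z ∧ (φ z = 0 → z = 0) := by
  induction hz using Submodule.span_induction with
  | mem x hx => exact ⟨(hφ x hx).le, fun h => absurd h (hφ x hx).ne'⟩
  | zero => simp
  | add x y _ _ hx hy =>
    rw [map_add]
    refine ⟨add_nonneg hx.1 hy.1, fun h => ?_⟩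
    rw [hx.2 (by linarith [hx.1, hy.1]), hy.2 (by linarith [hx.1, hy.1]), add_zero]
  | smul c x _ hx =>
    rw [NNReal.smul_def, map_smul, smul_eq_mul]
    refine ⟨mul_nonneg c.2 hx.1, fun h => ?_⟩
    rcases mul_eq_zero.1 h with h | h
    · rw [h, zero_smul]
    · rw [hx.2 h, smul_zero]

/-- A finite set in an open half-space is spanned by its elements that are closest to the origin
on the extreme rays of the cone it generates. -/
theorem exists_extreme_generators (T : Finset V) (φ : V →ₗ[ℝ] ℝ) (hφ : ∀ y ∈ T, 0 < φ y) :
    ∃ S ⊆ T, (T : Set V) ⊆ Submodule.span ℝ (S : Set V) ∧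
      ∀ y ∈ S, ∀ a ∈ T, ∀ b ∈ T, ∀ α β γ : ℝ, 0 < α → 0 < β →
        α • a + β • b = γ • y → α + β ≤ γ := by
  classical
  -- Minimising the total `φ`-weight of a generating set excludes redundant rays and, on each ray
  -- kept, selects the point nearest the origin.
  obtain ⟨S, hS, hmin⟩ := Finset.exists_min_image
    (T.powerset.filter fun S : Finset V => (T : Set V) ⊆ Submodule.span ℝ≥0 (S : Set V))
    (fun S => ∑ y ∈ S, φ y)
    ⟨T, by simp [Submodule.subset_span]⟩
  simp only [Finset.mem_filter, Finset.mem_powerset] at hS hmin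
  obtain ⟨hST, hTS⟩ := hS
  refine ⟨S, hST, fun x hx => ?_, ?_⟩
  · have h1 : Submodule.span ℝ≥0 (S : Set V)
        ≤ (Submodule.span ℝ (S : Set V)).restrictScalars ℝ≥0 :=
      Submodule.span_le.2 Submodule.subset_span
    exact h1 (hTS hx)
  intro y hy a ha b hb α β γ hα hβ h
  set S₀ := S.erase y with hS₀
  have hSi : (S : Set V) = insert y (S₀ : Set V) := by
    rw [← Finset.coe_insert, Finset.insert_erase hy]
  have hφy := hφ y (hST hy)
  have hsum : ∑ z ∈ S, φ z = φ y + ∑ z ∈ S₀, φ z := (Finset.add_sum_erase _ _ hy).symm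
  have hS₀T : S₀ ⊆ T := (Finset.erase_subset _ _).trans hST
  have hφ₀ : ∀ z ∈ (S₀ : Set V), 0 < φ z := fun z hz => hφ z (hS₀T hz)
  have hreplace : ∀ S' : Finset V, S' ⊆ T → S₀ ⊆ S' → y ∈ Submodule.span ℝ≥0 (S' : Set V) →
      φ y + ∑ z ∈ S₀, φ z ≤ ∑ z ∈ S', φ z := by
    intro S' hS'T hS₀S' hyS'
    rw [← hsum]
    refine hmin S' ⟨hS'T, hTS.trans ?_⟩
    have : Submodule.span ℝ≥0 (S : Set V) ≤ Submodule.span ℝ≥0 (S' : Set V) := by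
      rw [Submodule.span_le, hSi, Set.insert_subset_iff]
      exact ⟨hyS', fun z hz => Submodule.subset_span (hS₀S' hz)⟩
    exact this
  have ha' := hTS ha
  have hb' := hTS hb
  rw [hSi, SetLike.mem_coe, Submodule.mem_span_insert] at ha' hb'
  obtain ⟨ca, a', ha', rfl⟩ := ha'
  obtain ⟨cb, b', hb', rfl⟩ := hb'
  have hφa' := nonneg_and_eq_zero_of_mem_span_nnreal hφ₀ ha'
  have hφb' := nonneg_and_eq_zero_of_mem_span_nnreal hφ₀ hb'
  rw [NNReal.smul_def, NNReal.smul_def] at h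
  have hw : (γ - α * ca - β * cb) • y = α • a' + β • b' := by
    linear_combination (norm := module) (-1 : ℝ) • h
  -- A positive coefficient would put `y` in the cone of the other generators, and dropping `y`
  -- would lower the weight. Hence `φ` forces `a' = b' = 0`, so `a` and `b` lie on the ray of `y`.
  have hκ : γ - α * ca - β * cb ≤ 0 := by
    by_contra hpos
    push Not at hpos
    have hsmul : ∀ t : ℝ, 0 < t → ∀ z ∈ Submodule.span ℝ≥0 (S₀ : Set V),
        t • z ∈ Submodule.span ℝ≥0 (S₀ : Set V) := fun t ht z hz =>
      Submodule.smul_mem _ (⟨t, ht.le⟩ : ℝ≥0) hz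
    have hy0 : y ∈ Submodule.span ℝ≥0 (S₀ : Set V) := by
      have h1 : α • a' + β • b' ∈ Submodule.span ℝ≥0 (S₀ : Set V) :=
        Submodule.add_mem _ (hsmul α hα _ ha') (hsmul β hβ _ hb')
      rw [← hw] at h1
      have h2 := hsmul _ (inv_pos.2 hpos) _ h1
      rwa [inv_smul_smul₀ hpos.ne'] at h2
    have := hreplace S₀ hS₀T subset_rfl hy0
    linarith
  have hφw : (γ - α * ca - β * cb) * φ y = α * φ a' + β * φ b' := by
    have := congrArg φ hw
    simpa using this
  have h0 : (γ - α * ca - β * cb) * φ y ≤ 0 := mul_nonpos_of_nonpos_of_nonneg hκ hφy.le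
  have ha0 : 0 ≤ α * φ a' := mul_nonneg hα.le hφa'.1
  have hb0 : 0 ≤ β * φ b' := mul_nonneg hβ.le hφb'.1
  have hφa0 : φ a' = 0 := (mul_eq_zero.1 (by linarith : α * φ a' = 0)).resolve_left hα.ne'
  have hφb0 : φ b' = 0 := (mul_eq_zero.1 (by linarith : β * φ b' = 0)).resolve_left hβ.ne'
  have hγ : γ = α * ca + β * cb := by
    rw [hφa0, hφb0] at hφw
    have := (mul_eq_zero.1 (by linarith : (γ - α * ca - β * cb) * φ y = 0)).resolve_right hφy.ne'
    linarith
  have hone : ∀ c : ℝ≥0, c • y ∈ T → (1 : ℝ) ≤ c := by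
    intro c hc
    by_contra hlt
    push Not at hlt
    have hval : φ (c • y) = c * φ y := by rw [NNReal.smul_def, map_smul, smul_eq_mul]
    have hφc := hφ _ hc
    rw [hval] at hφc
    have hc0 : (0 : ℝ) < c := pos_of_mul_pos_left hφc hφy.le
    have hmem : y ∈ Submodule.span ℝ≥0 ((insert (c • y) S₀ : Finset V) : Set V) := by
      have h1 : c • y ∈ Submodule.span ℝ≥0 ((insert (c • y) S₀ : Finset V) : Set V) :=
        Submodule.subset_span (by simp)
      have h2 := Submodule.smul_mem _ c⁻¹ h1
      rwa [inv_smul_smul₀ (by exact_mod_cast hc0.ne')] at h2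
    have h3 := hreplace _ (Finset.insert_subset hc hS₀T) (Finset.subset_insert _ _) hmem
    have h4 : ∑ z ∈ insert (c • y) S₀, φ z ≤ φ (c • y) + ∑ z ∈ S₀, φ z := by
      by_cases hin : c • y ∈ S₀
      · rw [Finset.insert_eq_of_mem hin]
        linarith [hφ _ hc]
      · rw [Finset.sum_insert hin]
    rw [hval] at h4
    nlinarith
  rw [hφa'.2 hφa0, add_zero] at ha
  rw [hφb'.2 hφb0, add_zero] at hb
  have h1 := mul_le_mul_of_nonneg_left (hone ca ha) hα.le
  have h2 := mul_le_mul_of_nonneg_left (hone cb hb) hβ.le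
  linarith

theorem exists_dual_injOn (P : Finset V) : ∃ φ : V →ₗ[ℝ] ℝ, Set.InjOn φ P := by
  classical
  obtain ⟨φ, hφ⟩ := Module.exists_dual_forall_apply_ne_zero (K := ℝ)
    (fun z : P.offDiag => (z : V × V).1 - (z : V × V).2) (by
      rintro ⟨⟨x, y⟩, h⟩
      exact sub_ne_zero.2 (Finset.mem_offDiag.1 h).2.2)
  refine ⟨φ, fun x hx y hy h => ?_⟩
  by_contra hxy
  exact hφ ⟨(x, y), Finset.mem_offDiag.2 ⟨hx, hy, hxy⟩⟩ (by simp [h])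

theorem mem_affineSubspace_of_smul_eq {Q : AffineSubspace ℝ V} {x p₁ p₂ p₃ : V} {t u : ℝ}
    (h₁ : p₁ ∈ Q) (h₂ : p₂ ∈ Q) (h₃ : p₃ ∈ Q) (ht : t ≠ 0)
    (h : t • x = u • (p₁ - p₂) + t • p₃) : x ∈ Q := by
  have hx : x = (t⁻¹ * u) • (p₁ -ᵥ p₂) +ᵥ p₃ := by
    rw [← inv_smul_smul₀ ht x, h, smul_add, inv_smul_smul₀ ht, smul_smul]
    rfl
  rw [hx]
  exact Q.smul_vsub_vadd_mem _ h₁ h₂ h₃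

end Cone

/-! ### Adding one fibre of a linear projection. -/

section Fibers

variable {E V : Type*} [AddCommGroup E] [Module ℝ E] [AddCommGroup V] [Module ℝ V]

/-- The combinations of `x` with the points of `Y` do not occur as combinations of points of
`P`, and are distinct as far as they come from combinations in different orders. -/
structure AreNewSums (q s : ℝ) (P : Finset V) (x : V) (Y : Finset V) : Prop where
  self : ∀ a ∈ P, ∀ b ∈ P, q • x + s • x ≠ q • a + s • b
  left : ∀ y ∈ Y, ∀ a ∈ P, ∀ b ∈ P, q • x + s • y ≠ q • a + s • b
  right : ∀ y ∈ Y, ∀ a ∈ P, ∀ b ∈ P, q • y + s • x ≠ q • a + s • b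
  cross : ∀ y ∈ Y, ∀ y' ∈ Y, q • x + s • y ≠ q • y' + s • x

open Classical in
-- The listed sums of fibres are disjoint because their images under `π` are.
theorem card_dilateSum_add_le_of_areNewSums {q s : ℝ} (hq : 0 < q) (hs : 0 < s)
    (π : E →ₗ[ℝ] V) (A : Finset E) (x : V) {Y : Finset V} (hxY : x ∉ Y)
    (hnew : AreNewSums q s ((A.filter fun a => π a ≠ x).image π) x Y) :
    (dilateSum q s (A.filter fun a => π a ≠ x) (A.filter fun a => π a ≠ x)).card
      + (dilateSum q s (A.filter fun a => π a = x) (A.filter fun a => π a = x)).card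
      + ∑ y ∈ Y, (dilateSum q s (A.filter fun a => π a = x) (A.filter fun a => π a = y)).card
      + ∑ y ∈ Y, (dilateSum q s (A.filter fun a => π a = y) (A.filter fun a => π a = x)).card
      ≤ (dilateSum q s A A).card := by
  have hfib : ∀ {u v : V} {z : E},
      z ∈ dilateSum q s (A.filter fun a => π a = u) (A.filter fun a => π a = v) →
      π z = q • u + s • v := by
    intro u v z hz
    obtain ⟨a, ha, b, hb, rfl⟩ := mem_dilateSum.1 hz
    rw [map_add, map_smul, map_smul, (Finset.mem_filter.1 ha).2, (Finset.mem_filter.1 hb).2]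
  have hrest : ∀ {z : E},
      z ∈ dilateSum q s (A.filter fun a => π a ≠ x) (A.filter fun a => π a ≠ x) →
      ∃ a ∈ (A.filter fun a => π a ≠ x).image π, ∃ b ∈ (A.filter fun a => π a ≠ x).image π,
        π z = q • a + s • b := by
    intro z hz
    obtain ⟨a, ha, b, hb, rfl⟩ := mem_dilateSum.1 hz
    exact ⟨_, Finset.mem_image_of_mem _ ha, _, Finset.mem_image_of_mem _ hb, by simp⟩
  rw [← Finset.card_biUnion, ← Finset.card_biUnion, ← Finset.card_union_of_disjoint,
    ← Finset.card_union_of_disjoint, ← Finset.card_union_of_disjoint]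
  · apply Finset.card_le_card
    refine Finset.union_subset (Finset.union_subset (Finset.union_subset ?_ ?_) ?_) ?_
    · exact dilateSum_mono (Finset.filter_subset _ _) (Finset.filter_subset _ _)
    · exact dilateSum_mono (Finset.filter_subset _ _) (Finset.filter_subset _ _)
    · exact Finset.biUnion_subset.2 fun y _ =>
        dilateSum_mono (Finset.filter_subset _ _) (Finset.filter_subset _ _)
    · exact Finset.biUnion_subset.2 fun y _ =>
        dilateSum_mono (Finset.filter_subset _ _) (Finset.filter_subset _ _)
  · rw [Finset.disjoint_left]
    intro z hz hz'
    obtain ⟨y', hy', hz'⟩ := Finset.mem_biUnion.1 hz'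
    have e' := hfib hz'
    rw [Finset.mem_union, Finset.mem_union] at hz
    rcases hz with (hz | hz) | hz
    · obtain ⟨a, ha, b, hb, e⟩ := hrest hz
      exact hnew.right y' hy' a ha b hb (e'.symm.trans e)
    · have e := (hfib hz).symm.trans e'
      have := smul_right_injective V hq.ne' (add_right_cancel e)
      exact hxY (this ▸ hy')
    · obtain ⟨y, hy, hz⟩ := Finset.mem_biUnion.1 hz
      exact hnew.cross y hy y' hy' ((hfib hz).symm.trans e')
  · rw [Finset.disjoint_left]
    intro z hz hz'
    obtain ⟨y', hy', hz'⟩ := Finset.mem_biUnion.1 hz'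
    have e' := hfib hz'
    rw [Finset.mem_union] at hz
    rcases hz with hz | hz
    · obtain ⟨a, ha, b, hb, e⟩ := hrest hz
      exact hnew.left y' hy' a ha b hb (e'.symm.trans e)
    · have e := (hfib hz).symm.trans e'
      have := smul_right_injective V hs.ne' (add_left_cancel e)
      exact hxY (this ▸ hy')
  · rw [Finset.disjoint_left]
    intro z hz hz'
    obtain ⟨a, ha, b, hb, e⟩ := hrest hz
    exact hnew.self a ha b hb ((hfib hz').symm.trans e)
  · intro y _ y' _ hyy
    change Disjoint _ _
    rw [Finset.disjoint_left]
    intro z hz hz'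
    exact hyy (smul_right_injective V hq.ne' (add_right_cancel ((hfib hz).symm.trans (hfib hz'))))
  · intro y _ y' _ hyy
    change Disjoint _ _
    rw [Finset.disjoint_left]
    intro z hz hz'
    exact hyy (smul_right_injective V hs.ne' (add_left_cancel ((hfib hz).symm.trans (hfib hz'))))

/-- Any coincidence could be solved for `x` as an affine combination of points of `P`; for `cross`
the divisor is `q - s`. -/
theorem areNewSums_of_notMem_affineSpan {q s : ℝ} (hq : 0 < q) (hs : 0 < s) (hqs : q ≠ s)
    {P : Finset V} {x : V} (hx : x ∉ affineSpan ℝ (P : Set V)) : AreNewSums q s P x P := by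
  have hP : ∀ a ∈ P, a ∈ affineSpan ℝ (P : Set V) := fun a ha => subset_affineSpan ℝ _ ha
  refine ⟨fun a ha b hb h => ?_, fun y hy a ha b hb h => ?_, fun y hy a ha b hb h => ?_,
    fun y hy y' hy' h => ?_⟩
  · exact hx (mem_affineSubspace_of_smul_eq (t := q + s) (u := s) (hP b hb) (hP a ha) (hP a ha)
      (add_pos hq hs).ne' (by linear_combination (norm := module) (1 : ℝ) • h))
  · exact hx (mem_affineSubspace_of_smul_eq (t := q) (u := s) (hP b hb) (hP y hy) (hP a ha)
      hq.ne' (by linear_combination (norm := module) (1 : ℝ) • h))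
  · exact hx (mem_affineSubspace_of_smul_eq (t := s) (u := q) (hP a ha) (hP y hy) (hP b hb)
      hs.ne' (by linear_combination (norm := module) (1 : ℝ) • h))
  · exact hx (mem_affineSubspace_of_smul_eq (t := q - s) (u := s) (hP y' hy') (hP y hy)
      (hP y' hy') (sub_ne_zero.2 hqs) (by linear_combination (norm := module) (1 : ℝ) • h))

/-- Seen from `x`, take the extreme generators of `P`. A coincidence with two points of `P` would
give `q + s ≤ s` or `q + s ≤ q`; one between the two orders would give both `s ≤ q` and `q ≤ s`. The
generators span, hence their number. -/
theorem exists_areNewSums {q s : ℝ} (hq : 0 < q) (hs : 0 < s) (hqs : q ≠ s)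
    {P : Finset V} {x : V} (φ : V →ₗ[ℝ] ℝ) (hφ : ∀ a ∈ P, φ x < φ a) :
    ∃ Y ⊆ P, AreNewSums q s P x Y ∧
      Module.finrank ℝ (vectorSpan ℝ (insert x (P : Set V))) ≤ Y.card := by
  classical
  have hT : ∀ a ∈ P, a - x ∈ P.image (fun a => a - x) := fun a ha => Finset.mem_image_of_mem _ ha
  obtain ⟨S, hST, hspan, hext⟩ := exists_extreme_generators (P.image fun a => a - x) φ (by
    intro y hy
    obtain ⟨a, ha, rfl⟩ := Finset.mem_image.1 hy
    rw [map_sub]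
    linarith [hφ a ha])
  have hYS : ∀ y ∈ S.image (fun z => z + x), y - x ∈ S := by
    intro y hy
    obtain ⟨z, hz, rfl⟩ := Finset.mem_image.1 hy
    simpa using hz
  refine ⟨S.image fun z => z + x, ?_, ⟨?_, ?_, ?_, ?_⟩, ?_⟩
  · intro y hy
    obtain ⟨a, ha, hax⟩ := Finset.mem_image.1 (hST (hYS y hy))
    rwa [← sub_left_inj.1 hax]
  · intro a ha b hb h
    have h1 := congrArg φ h
    simp only [map_add, map_smul, smul_eq_mul] at h1
    nlinarith [mul_lt_mul_of_pos_left (hφ a ha) hq, mul_lt_mul_of_pos_left (hφ b hb) hs]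
  · intro y hy a ha b hb h
    have := hext _ (hYS y hy) _ (hT a ha) _ (hT b hb) q s s hq hs
      (by linear_combination (norm := module) (-1 : ℝ) • h)
    linarith
  · intro y hy a ha b hb h
    have := hext _ (hYS y hy) _ (hT a ha) _ (hT b hb) q s q hq hs
      (by linear_combination (norm := module) (-1 : ℝ) • h)
    linarith
  · intro y hy y' hy' h
    have h1 := hext _ (hYS y' hy') _ (hST (hYS y hy)) _ (hST (hYS y hy)) (s / 2) (s / 2) q
      (by positivity) (by positivity) (by linear_combination (norm := module) (1 : ℝ) • h)
    have h2 := hext _ (hYS y hy) _ (hST (hYS y' hy')) _ (hST (hYS y' hy')) (q / 2) (q / 2) s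
      (by positivity) (by positivity) (by linear_combination (norm := module) (-1 : ℝ) • h)
    exact hqs (by linarith)
  · rw [Finset.card_image_of_injective _ (add_left_injective x)]
    have h1 : vectorSpan ℝ (insert x (P : Set V)) ≤ Submodule.span ℝ (S : Set V) := by
      rw [vectorSpan_eq_span_vsub_set_right ℝ (Set.mem_insert x _), Submodule.span_le]
      rintro _ ⟨a, ha, rfl⟩
      rcases ha with rfl | ha
      · simp
      · exact hspan (hT a ha)
    exact (Submodule.finrank_mono h1).trans (finrank_span_finset_le_card S)

open Classical in
theorem card_dilateSum_ge_of_fibers {q s C : ℝ} (hq : 0 < q) (hs : 0 < s) (hqs : q ≠ s)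
    (π : E →ₗ[ℝ] V)
    (hC : ∀ X : Finset E, (∀ x ∈ X, ∀ y ∈ X, π x = π y) →
      (q + s) * X.card - C ≤ (dilateSum q s X X).card) (A : Finset E) :
    (q + s + 2 * (Module.finrank ℝ (vectorSpan ℝ (A.image π : Set V)) : ℝ)) * A.card
      - C * (A.image π).card
      - (Module.finrank ℝ (vectorSpan ℝ (A.image π : Set V)) : ℝ)
        * ((Module.finrank ℝ (vectorSpan ℝ (A.image π : Set V)) : ℝ) + 1)
      ≤ (dilateSum q s A A).card := by
  have : IsAddTorsionFree E := IsAddTorsionFree.of_isTorsionFree ℝ E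
  induction A using Finset.strongInduction with
  | H A ih =>
  rcases A.eq_empty_or_nonempty with rfl | hA
  · simp only [Finset.image_empty, Finset.card_empty, Nat.cast_zero, mul_zero, sub_zero, zero_sub]
    exact (neg_nonpos.2 (by positivity)).trans (Nat.cast_nonneg _)
  obtain ⟨φ, hφ⟩ := exists_dual_injOn (A.image π)
  obtain ⟨x, hxP, hmin⟩ := Finset.exists_min_image (A.image π) φ (hA.image π)
  set A' := A.filter fun a => π a ≠ x with hA'
  set Ax := A.filter fun a => π a = x with hAx
  have hP : A.image π = insert x (A'.image π) := by
    ext y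
    simp only [Finset.mem_image, Finset.mem_insert, hA', Finset.mem_filter]
    constructor
    · rintro ⟨a, ha, rfl⟩
      by_cases h : π a = x
      · exact Or.inl h
      · exact Or.inr ⟨a, ⟨ha, h⟩, rfl⟩
    · rintro (rfl | ⟨a, ⟨ha, -⟩, rfl⟩)
      · simpa using hxP
      · exact ⟨a, ha, rfl⟩
  have hxP' : x ∉ A'.image π := by
    simp [hA']
  have hAxne : Ax.Nonempty := by
    obtain ⟨a, ha, hax⟩ := Finset.mem_image.1 hxP
    exact ⟨a, Finset.mem_filter.2 ⟨ha, hax⟩⟩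
  have hcardA : Ax.card + A'.card = A.card := Finset.card_filter_add_card_filter_not _
  have hssub : A' ⊂ A := by
    refine Finset.ssubset_iff_subset_ne.2 ⟨Finset.filter_subset _ _, fun h => ?_⟩
    rw [h] at hcardA
    have := hAxne.card_pos
    omega
  have hφ' : ∀ a ∈ A'.image π, φ x < φ a := by
    intro a ha
    have haP : a ∈ A.image π := hP ▸ Finset.mem_insert_of_mem ha
    refine lt_of_le_of_ne (hmin a haP) fun h => hxP' ?_
    rwa [hφ hxP haP h]
  have hIH := ih A' hssub
  have hcardP : (A.image π).card = (A'.image π).card + 1 := by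
    rw [hP, Finset.card_insert_of_notMem hxP']
  have hC' := hC Ax (by
    intro a ha b hb
    rw [(Finset.mem_filter.1 ha).2, (Finset.mem_filter.1 hb).2])
  have hgain : ∀ Y ⊆ A'.image π, AreNewSums q s (A'.image π) x Y →
      ((dilateSum q s A' A').card : ℝ) + ((q + s) * Ax.card - C)
        + 2 * (Y.card * ((Ax.card : ℝ) - 1) + ∑ y ∈ Y, ((A.filter fun a => π a = y).card : ℝ))
        ≤ (dilateSum q s A A).card := by
    intro Y hY hnew
    have h := card_dilateSum_add_le_of_areNewSums hq hs π A x (fun h => hxP' (hY h)) hnew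
    have h' : ((dilateSum q s A' A').card : ℝ) + (dilateSum q s Ax Ax).card
      + ∑ y ∈ Y, ((dilateSum q s Ax (A.filter fun a => π a = y)).card : ℝ)
      + ∑ y ∈ Y, ((dilateSum q s (A.filter fun a => π a = y) Ax).card : ℝ)
      ≤ (dilateSum q s A A).card := by exact_mod_cast h
    have hne : ∀ y ∈ Y, (A.filter fun a => π a = y).Nonempty := by
      intro y hy
      obtain ⟨a, ha, hay⟩ := Finset.mem_image.1 (hY hy)
      exact ⟨a, Finset.mem_filter.2 ⟨hssub.1 ha, hay⟩⟩
    have hinj : ∀ {t : ℝ}, 0 < t → Function.Injective fun z : E => t • z :=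
      fun ht => smul_right_injective E ht.ne'
    have h1 : ∀ y ∈ Y, ((Ax.card : ℝ) - 1) + (A.filter fun a => π a = y).card
        ≤ (dilateSum q s Ax (A.filter fun a => π a = y)).card := by
      intro y hy
      have := card_dilateSum_ge (q := q) (s := s) (hinj hq) (hinj hs) hAxne (hne y hy)
      have : (Ax.card : ℝ) + (A.filter fun a => π a = y).card
        ≤ (dilateSum q s Ax (A.filter fun a => π a = y)).card + 1 := by exact_mod_cast this
      linarith
    have h2 : ∀ y ∈ Y, ((Ax.card : ℝ) - 1) + (A.filter fun a => π a = y).card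
        ≤ (dilateSum q s (A.filter fun a => π a = y) Ax).card := by
      intro y hy
      have := card_dilateSum_ge (q := q) (s := s) (hinj hq) (hinj hs) (hne y hy) hAxne
      have : ((A.filter fun a => π a = y).card : ℝ) + Ax.card
        ≤ (dilateSum q s (A.filter fun a => π a = y) Ax).card + 1 := by exact_mod_cast this
      linarith
    have h3 := Finset.sum_le_sum h1
    have h4 := Finset.sum_le_sum h2
    rw [Finset.sum_add_distrib, Finset.sum_const, nsmul_eq_mul] at h3 h4
    linarith
  have hfib1 : ∀ Y ⊆ A'.image π, (Y.card : ℝ) ≤ ∑ y ∈ Y, ((A.filter fun a => π a = y).card : ℝ) := by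
    intro Y hY
    rw [Finset.card_eq_sum_ones, Nat.cast_sum]
    apply Finset.sum_le_sum
    intro y hy
    obtain ⟨a, ha, hay⟩ := Finset.mem_image.1 (hY hy)
    have : (A.filter fun a => π a = y).Nonempty := ⟨a, Finset.mem_filter.2 ⟨hssub.1 ha, hay⟩⟩
    exact_mod_cast this.card_pos
  have hAx1 : (1 : ℝ) ≤ Ax.card := by exact_mod_cast hAxne.card_pos
  have hcardA' : (A.card : ℝ) = Ax.card + A'.card := by exact_mod_cast hcardA.symm
  have hcardP' : ((A.image π).card : ℝ) = (A'.image π).card + 1 := by exact_mod_cast hcardP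
  have hPcoe : (A.image π : Set V) = insert x (A'.image π : Set V) := by
    rw [hP, Finset.coe_insert]
  obtain ⟨Y₀, hY₀, hnew₀, hk₀⟩ := exists_areNewSums hq hs hqs φ hφ'
  rw [← hPcoe] at hk₀
  set k := Module.finrank ℝ (vectorSpan ℝ (A.image π : Set V)) with hk
  set k' := Module.finrank ℝ (vectorSpan ℝ (A'.image π : Set V)) with hk'
  rcases eq_or_ne k k' with hkk | hkk
  -- Dimension unchanged: at least `k` points contribute `2 * Ax.card` each, the Cauchy–Davenport
  -- losses being covered by the nonempty fibres over `Y₀`.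
  · have h1 := hgain Y₀ hY₀ hnew₀
    have h2 := hfib1 Y₀ hY₀
    have h3 : (k : ℝ) * Ax.card ≤ Y₀.card * Ax.card := by gcongr
    rw [← hkk] at hIH
    rw [hcardA', hcardP']
    linarith
  · have hxaff : x ∉ affineSpan ℝ (A'.image π : Set V) := by
      intro hx
      apply hkk
      rw [hk, hk', hPcoe, ← direction_affineSpan, ← direction_affineSpan,
        affineSpan_insert_eq_affineSpan ℝ hx]
    have hle : k ≤ k' + 1 := by
      rw [hk, hPcoe]
      exact finrank_vectorSpan_insert_le_set ℝ _ x
    have hge : k' ≤ k := by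
      have : FiniteDimensional ℝ (vectorSpan ℝ (A.image π : Set V)) :=
        finiteDimensional_vectorSpan_of_finite ℝ (Finset.finite_toSet _)
      apply Submodule.finrank_mono
      apply vectorSpan_mono
      rw [hPcoe]
      exact Set.subset_insert _ _
    have hkk' : (k : ℝ) = k' + 1 := by
      have : k = k' + 1 := by omega
      exact_mod_cast this
    -- Dimension increased: using every point of the old image adds `2 * A'.card`, raising the slope
    -- on `A'`. The loss of `2 * k` is the increment of `k * (k + 1)`.
    have h1 := hgain _ subset_rfl (areNewSums_of_notMem_affineSpan hq hs hqs hxaff)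
    have h2 : ∑ y ∈ A'.image π, ((A.filter fun a => π a = y).card : ℝ) = A'.card := by
      rw [Finset.card_eq_sum_card_image π A', Nat.cast_sum]
      apply Finset.sum_congr rfl
      intro y hy
      congr 2
      ext a
      simp only [hA', Finset.mem_filter]
      constructor
      · rintro ⟨ha, rfl⟩
        exact ⟨⟨ha, fun h => hxP' (h ▸ hy)⟩, rfl⟩
      · rintro ⟨⟨ha, -⟩, hay⟩
        exact ⟨ha, hay⟩
    have h3 : (k : ℝ) ≤ (A'.image π).card := by
      exact_mod_cast hk₀.trans (Finset.card_le_card hY₀)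
    rw [h2] at h1
    rw [hcardA', hcardP', hkk']
    rw [hkk'] at h3
    have h4 : 0 ≤ ((A'.image π).card - ((k' : ℝ) + 1)) * ((Ax.card : ℝ) - 1) :=
      mul_nonneg (by linarith) (by linarith)
    linarith

end Fibers

/-! ### Sets covered by parallel lines. -/

theorem IsDilateConst.le_card_of_sub_mem {E : Type*} [AddCommGroup E] [Module ℝ E] {q s : ℤ}
    {C : ℝ} (hC : IsDilateConst q s C) (hq : 0 < q) (hs : 0 < s) {D : Submodule ℝ E}
    (hD : Module.finrank ℝ D = 1) {X : Finset E} (hX : ∀ x ∈ X, ∀ y ∈ X, x - y ∈ D) :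
    ((q : ℝ) + s) * X.card - C ≤ (dilateSum (q : ℝ) (s : ℝ) X X).card := by
  classical
  rcases X.eq_empty_or_nonempty with rfl | ⟨x₀, hx₀⟩
  · simpa using (neg_nonpos.2 hC.nonneg).trans (Nat.cast_nonneg _)
  obtain ⟨⟨v, hvD⟩, hv, hspan⟩ := finrank_eq_one_iff'.1 hD
  have hv0 : v ≠ 0 := fun h => hv (Subtype.ext h)
  have hcoord : ∀ x ∈ X, ∃ c : ℝ, x₀ + c • v = x := by
    intro x hx
    obtain ⟨c, hc⟩ := hspan ⟨x - x₀, hX x hx x₀ hx₀⟩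
    refine ⟨c, ?_⟩
    have : c • v = x - x₀ := congrArg Subtype.val hc
    rw [this, add_sub_cancel]
  choose! c hc using hcoord
  have hcinj : Set.InjOn c X := by
    intro x hx y hy h
    rw [← hc x hx, ← hc y hy, h]
  have h1 := hC (X.image c : Set ℝ) (Finset.finite_toSet _)
  have hq' : (0 : ℝ) < q := by exact_mod_cast hq
  have hs' : (0 : ℝ) < s := by exact_mod_cast hs
  rw [← coe_dilateSum, Set.ncard_coe_finset, Set.ncard_coe_finset, abs_of_pos hq', abs_of_pos hs',
    Finset.card_image_of_injOn hcinj] at h1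
  refine h1.trans ?_
  have h2 : (dilateSum (q : ℝ) (s : ℝ) (X.image c) (X.image c)).card
      ≤ (dilateSum (q : ℝ) (s : ℝ) X X).card := by
    apply Finset.card_le_card_of_injOn fun z => ((q : ℝ) + s) • x₀ + z • v
    · intro z hz
      simp only [Finset.mem_coe, mem_dilateSum, Finset.mem_image] at hz
      obtain ⟨_, ⟨x, hx, rfl⟩, _, ⟨y, hy, rfl⟩, rfl⟩ := hz
      refine mem_dilateSum.2 ⟨x, hx, y, hy, ?_⟩
      conv_lhs => rw [← hc x hx, ← hc y hy]
      module
    · intro z _ z' _ h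
      exact smul_left_injective ℝ hv0 (add_left_cancel h)
  exact_mod_cast h2

theorem ncard_ge_of_subset_parallel_lines {q s : ℤ} (hq : 0 < q) (hs : 0 < s) (hqs : q ≠ s)
    {C : ℝ} (hC : IsDilateConst q s C) {d r : ℕ} (hd : 1 ≤ d)
    {l : Fin r → AffineSubspace ℝ (EuclideanSpace ℝ (Fin d))}
    (hl : ∀ i, IsLine (l i)) (hpar : ∀ i j, (l i).Parallel (l j))
    {A : Set (EuclideanSpace ℝ (Fin d))} (hA : A.Finite) (hdim : affineDim A = d)
    (hAl : A ⊆ ⋃ i, (l i : Set (EuclideanSpace ℝ (Fin d)))) :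
    ((q : ℝ) + s + 2 * d - 2) * A.ncard - (d * (d + 1) * C + d * (d + 1) + C) * r
      ≤ ((q : ℝ) • A + (s : ℝ) • A).ncard := by
  classical
  lift A to Finset (EuclideanSpace ℝ (Fin d)) using hA
  have hq' : (0 : ℝ) < q := by exact_mod_cast hq
  have hs' : (0 : ℝ) < s := by exact_mod_cast hs
  have hC0 := hC.nonneg
  have hspanA : vectorSpan ℝ (A : Set (EuclideanSpace ℝ (Fin d))) = ⊤ := by
    apply Submodule.eq_top_of_finrank_eq
    rw [← direction_affineSpan]
    exact hdim.trans (by simp)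
  have hAne : A.Nonempty := by
    rw [Finset.nonempty_iff_ne_empty]
    rintro rfl
    rw [Finset.coe_empty, vectorSpan_empty] at hspanA
    have := congrArg (fun W : Submodule ℝ (EuclideanSpace ℝ (Fin d)) => Module.finrank ℝ W) hspanA
    simp at this
    omega
  obtain ⟨a₀, ha₀⟩ := hAne
  obtain ⟨i₀, -⟩ := Set.mem_iUnion.1 (hAl ha₀)
  have hr : (1 : ℝ) ≤ r := by exact_mod_cast i₀.pos
  set D := (l i₀).direction with hDdef
  have hD : Module.finrank ℝ D = 1 := hl i₀
  have hdir : ∀ i, (l i).direction = D := fun i => (hpar i i₀).direction_eq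
  have hmk : ∀ {x y : EuclideanSpace ℝ (Fin d)}, D.mkQ x = D.mkQ y ↔ x - y ∈ D := by
    intro x y
    rw [Submodule.mkQ_apply, Submodule.mkQ_apply, Submodule.Quotient.eq]
  have hmain := card_dilateSum_ge_of_fibers (C := C) hq' hs' (by exact_mod_cast hqs) D.mkQ
    (fun X hX => hC.le_card_of_sub_mem hq hs hD fun x hx y hy => hmk.1 (hX x hx y hy)) A
  -- The image of a spanning set spans the quotient by the line direction, which has dimension `d -
  -- 1`.
  have hdimP : ((Module.finrank ℝ (vectorSpan ℝ
      (A.image D.mkQ : Set (EuclideanSpace ℝ (Fin d) ⧸ D))) : ℕ) : ℝ) = d - 1 := by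
    have h1 : vectorSpan ℝ (A.image D.mkQ : Set (EuclideanSpace ℝ (Fin d) ⧸ D)) = ⊤ := by
      have := AffineMap.map_vectorSpan (D.mkQ.toAffineMap)
        (s := (A : Set (EuclideanSpace ℝ (Fin d))))
      rw [hspanA] at this
      rw [Finset.coe_image]
      rw [LinearMap.toAffineMap_linear, Submodule.map_top, Submodule.range_mkQ] at this
      exact this.symm
    have h2 := D.finrank_quotient_add_finrank
    rw [hD, finrank_euclideanSpace_fin] at h2
    rw [h1, finrank_top]
    have : ((Module.finrank ℝ (EuclideanSpace ℝ (Fin d) ⧸ D) : ℕ) : ℝ) + 1 = d := by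
      exact_mod_cast h2
    linarith
  have hcardP : ((A.image D.mkQ).card : ℝ) ≤ r := by
    have hline : ∀ a ∈ A, ∃ i, a ∈ l i := fun a ha => Set.mem_iUnion.1 (hAl ha)
    have : Nonempty (Fin r) := ⟨i₀⟩
    choose! i hi using hline
    have hP : ∀ y ∈ A.image D.mkQ, ∃ a ∈ A, D.mkQ a = y := fun y hy => Finset.mem_image.1 hy
    choose! a ha hay using hP
    have := Finset.card_le_card_of_injOn (s := A.image D.mkQ) (t := Finset.univ)
      (fun y => i (a y)) (fun _ _ => Finset.mem_coe.2 (Finset.mem_univ _)) (by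
        intro y hy y' hy' h
        rw [← hay y hy, ← hay y' hy', hmk, ← hdir (i (a y))]
        have h1 := hi _ (ha y hy)
        have h2 := hi _ (ha y' hy')
        simp only at h
        rw [← h] at h2
        exact AffineSubspace.vsub_mem_direction h1 h2)
    rw [Finset.card_univ, Fintype.card_fin] at this
    exact_mod_cast this
  rw [hdimP] at hmain
  rw [← coe_dilateSum, Set.ncard_coe_finset, Set.ncard_coe_finset]
  -- The fibre argument loses only `C` per fibre plus `(d - 1) * d`; as `r ≥ 1`, this is at most the
  -- stated constant times `r`.
  refine le_trans ?_ hmain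
  have hd' : (1 : ℝ) ≤ d := by exact_mod_cast hd
  have h1 : C * (A.image D.mkQ).card ≤ C * r := mul_le_mul_of_nonneg_left hcardP hC0
  have h2 : 0 ≤ (d : ℝ) * (d + 1) * C * r := by positivity
  have h3 : (d : ℝ) * (d + 1) ≤ d * (d + 1) * r := le_mul_of_one_le_right (by positivity) hr
  linarith

theorem proposition4p1 (q s : ℤ) (hcop : IsCoprime q s) (hqs : 1 < q * s) :
    IsLeast {C : ℝ | IsDilateConst q s C} (dilateConst q s) ∧
    ∀ (d : ℕ), 1 ≤ d →
    ∀ (r : ℕ) (l : Fin r → AffineSubspace ℝ (EuclideanSpace ℝ (Fin d))),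
      (∀ i, IsLine (l i)) → (∀ i j, (l i).Parallel (l j)) →
    ∀ A : Set (EuclideanSpace ℝ (Fin d)), A.Finite → affineDim A = d →
      A ⊆ ⋃ i, (l i : Set (EuclideanSpace ℝ (Fin d))) →
      (|(q : ℝ)| + |(s : ℝ)| + 2 * (d : ℝ) - 2) * (A.ncard : ℝ) - linesConst q s d * (r : ℝ)
        ≤ (((q : ℝ) • A + (s : ℝ) • A).ncard : ℝ) := by
  have hleast := isLeast_dilateConst hcop hqs
  refine ⟨hleast, fun d hd r l hl hpar A hA hdim hAl => ?_⟩
  have hne : q ≠ s := by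
    rintro rfl
    rcases Int.isUnit_iff.1 (isCoprime_self.1 hcop) with rfl | rfl <;> norm_num at hqs
  rcases pos_or_neg_of_one_lt_mul hqs with ⟨hq, hs⟩ | ⟨hq, hs⟩
  · have hq' : (0 : ℝ) < q := by exact_mod_cast hq
    have hs' : (0 : ℝ) < s := by exact_mod_cast hs
    rw [abs_of_pos hq', abs_of_pos hs', linesConst]
    exact ncard_ge_of_subset_parallel_lines hq hs hne hleast.1 hd hl hpar hA hdim hAl
  · have hq' : (q : ℝ) < 0 := by exact_mod_cast neg_pos.1 hq
    have hs' : (s : ℝ) < 0 := by exact_mod_cast neg_pos.1 hs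
    rw [abs_of_neg hq', abs_of_neg hs', linesConst, ← ncard_neg_smul_add_neg_smul]
    have := ncard_ge_of_subset_parallel_lines hq hs (neg_injective.ne hne)
      (isDilateConst_neg.2 hleast.1) hd hl hpar hA hdim hAl
    push_cast at this
    exact this
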